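/- Let $X$ be a finite distance-regular graph (in particular connected) with adjacency matrix $A$ and distinct eigenvalues $\lambda_0 > \lambda_1 > \dots > \lambda_d$, and let $U(t) = e^{itA}$. Say that perfect state transfer occurs on $X$ at time $t$ if there are distinct vertices $u, v$ and $\gamma \in \mathbb{C}$ with $U(t)e_u = \gamma e_v$, where $e_w$ denotes the standard basis vector of the vertex $w$. Then, for every real $t$, perfect state transfer occurs on $X$ at time $t$ if and only if all of the following hold: (i) $X$ is antipodal with classes of size $2$, that is, the relation "equal or at distance equal to the diameter of $X$" is an equivalence relation on the vertices all of whose classes have exactly two elements; (ii) all eigenvalues $\lambda_0, \dots, \lambda_d$ are integers; (iii) with $\alpha = \gcd\{\lambda_0 - \lambda_k : 0 \le k \le d\}$, and $\mathrm{ord}_2(x)$ the exponent of $2$ in the integer $x$ (with $\mathrm{ord}_2(0) = +\infty$), one has $\mathrm{ord}_2(\lambda_0 - \lambda_j) > \mathrm{ord}_2(\alpha)$ for every even $j$ and $\mathrm{ord}_2(\lambda_0 - \lambda_j) = \mathrm{ord}_2(\alpha)$ for every odd $j$; moreover, $t$ is an odd (integer) multiple of $\pi/\alpha$. -/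

import Mathlib

open scoped Matrix

namespace QuantumWalk

variable {V : Type*}

/-- A graph is distance-regular if it is connected and there are numbers `b i`, `c i` such that
for any vertices `u`, `v` at distance `i`, exactly `c i` neighbours of `v` lie at distance `i - 1`
from `u` and exactly `b i` neighbours of `v` lie at distance `i + 1` from `u`. -/
def IsDistanceRegular (X : SimpleGraph V) : Prop :=
  X.Connected ∧ ∃ b c : ℕ → ℕ, ∀ u v : V,
    {w | X.Adj v w ∧ X.dist u w + 1 = X.dist u v}.ncard = c (X.dist u v) ∧
    {w | X.Adj v w ∧ X.dist u w = X.dist u v + 1}.ncard = b (X.dist u v)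

/-- Two vertices are antipodally related if they are equal or their distance is the diameter. -/
def AntipodalRel (X : SimpleGraph V) (u v : V) : Prop :=
  u = v ∨ X.dist u v = X.diam

/-- The graph is antipodal (the distance-`d` graph, `d` the diameter, is a disjoint union of
cliques: being equal or at distance `d` is an equivalence relation) and every antipodal class
has exactly `r` vertices. -/
def IsAntipodalWithClassSize (X : SimpleGraph V) (r : ℕ) : Prop :=
  Equivalence (AntipodalRel X) ∧ ∀ u : V, {v | AntipodalRel X u v}.ncard = r

/-- The transition matrix `U(t) = exp(i t A)` of the continuous-time quantum walk. -/
noncomputable def transitionMatrix [Fintype V] [DecidableEq V] (X : SimpleGraph V)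
    [DecidableRel X.Adj] (t : ℝ) : Matrix V V ℂ :=
  NormedSpace.exp ((Complex.I * (t : ℂ)) • X.adjMatrix ℂ)

/-- Perfect state transfer on `X` at time `t`: there are distinct vertices `u`, `v` and a complex
number `γ` with `U(t) e_u = γ e_v`. -/
def HasPerfectStateTransfer [Fintype V] [DecidableEq V] (X : SimpleGraph V)
    [DecidableRel X.Adj] (t : ℝ) : Prop :=
  ∃ u v : V, u ≠ v ∧ ∃ γ : ℂ,
    transitionMatrix X t *ᵥ (Pi.single u 1 : V → ℂ) = γ • (Pi.single v 1 : V → ℂ)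

/-- `θ` lists the distinct eigenvalues of the adjacency matrix in strictly decreasing order. -/
def IsDistinctEigenvalues [Fintype V] [DecidableEq V] (X : SimpleGraph V)
    [DecidableRel X.Adj] {d : ℕ} (θ : Fin (d + 1) → ℝ) : Prop :=
  StrictAnti θ ∧
    ∀ x : ℝ, Module.End.HasEigenvalue (Matrix.toLin' (X.adjMatrix ℝ)) x ↔ ∃ j, θ j = x

/-- The exponent of `2` in an integer, with `ord₂ 0 = ⊤`. -/
noncomputable def ord₂ (x : ℤ) : ℕ∞ := emultiplicity 2 x

/-- `gcd {μ 0 - μ k : k}`, the nonnegative greatest common divisor. -/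
def eigenvalueGCD {d : ℕ} (μ : Fin (d + 1) → ℤ) : ℤ :=
  Finset.univ.gcd (fun k => μ 0 - μ k)

end QuantumWalk

/-! Write `A_k` for the distance-`k` matrix. In a distance-regular graph every polynomial in `A` has
entries depending only on distance, and `U(t)` is such a polynomial by interpolation. Transfer from
`u` to `v` at distance `k` therefore forces `U(t) = γ A_k`, with exactly one vertex at distance `k`
from each vertex; this is possible only for `k = diam` (`diam_le_of_unique_dist`), so the graph is
antipodal with classes of size 2.

In that case `A_diam = p(A)` is an involution fixing the all-ones vector, and its eigenvalues
alternate, `p(θ_j) = (-1)^j`. Indeed, if `p` agreed at two consecutive eigenvalues, let `q` vanish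
at all the others: `tr (p q)(A) = 0` because `q(A)` vanishes at distance `diam`, yet its nonzero
spectral terms would share one sign. Transfer thus amounts to `t (θ_0 - θ_j) ∈ π (j + 2ℤ)` for all
`j`.

Summing these phases with multiplicity and using `tr A = 0` makes `t / π` rational. The eigenvalues
are then rational algebraic integers, hence integers, and the rest is parity arithmetic with the
gcd. -/

namespace QuantumWalk

section

open Polynomial

/-! ### Distances in distance-regular graphs -/

section Distance

variable {V : Type*} {X : SimpleGraph V}

theorem exists_adj_dist_eq (hX : X.Connected) {u v : V} {n : ℕ} (h : X.dist u v = n + 1) :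
    ∃ w, X.Adj w v ∧ X.dist u w = n := by
  obtain ⟨p, hp⟩ := hX.exists_walk_length_eq_dist v u
  cases p with
  | nil => simp at h
  | @cons _ w _ hvw q =>
    refine ⟨w, hvw.symm, ?_⟩
    have h1 : X.dist u w ≤ q.length := by rw [X.dist_comm]; exact X.dist_le q
    have h2 : X.dist u v ≤ X.dist u w + X.dist w v := hX.dist_triangle
    rw [SimpleGraph.dist_eq_one_iff_adj.2 hvw.symm] at h2
    rw [SimpleGraph.Walk.length_cons, SimpleGraph.dist_comm (u := v)] at hp
    omega

theorem dist_le_diam_of_connected [Finite V] (hX : X.Connected) (u v : V) :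
    X.dist u v ≤ X.diam := by
  have := hX.nonempty
  exact SimpleGraph.dist_le_diam (SimpleGraph.connected_iff_ediam_ne_top.1 hX)

theorem exists_dist_eq_of_le (hX : X.Connected) {u v : V} {n : ℕ} (h : n ≤ X.dist u v) :
    ∃ w, X.dist u w = n := by
  generalize hm : X.dist u v = m at h
  induction m generalizing v with
  | zero => exact ⟨v, by omega⟩
  | succ m ih =>
    rcases Nat.lt_or_ge n (m + 1) with hn | hn
    · obtain ⟨w, -, hw⟩ := exists_adj_dist_eq hX hm
      exact ih hw (by omega)
    · exact ⟨v, by omega⟩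

/-- In a distance-regular graph every vertex that is not at distance `diam` from `u` has a
neighbour farther away from `u`. -/
theorem IsDistanceRegular.exists_adj_farther [Finite V] (hX : IsDistanceRegular X) {u v : V}
    (h : X.dist u v < X.diam) : ∃ w, X.Adj v w ∧ X.dist u w = X.dist u v + 1 := by
  obtain ⟨hc, b, c, hbc⟩ := hX
  have := hc.nonempty
  obtain ⟨x, y, hxy⟩ := X.exists_dist_eq_diam
  obtain ⟨z, hz⟩ := exists_dist_eq_of_le hc (u := x) (v := y) (n := X.dist u v + 1) (by omega)
  obtain ⟨w, hwz, hw⟩ := exists_adj_dist_eq hc hz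
  have h1 := (hbc x w).2
  rw [hw] at h1
  have h2 := (hbc u v).2
  have h3 : {w_1 | X.Adj w w_1 ∧ X.dist x w_1 = X.dist u v + 1}.ncard ≠ 0 :=
    Set.ncard_ne_zero_of_mem (a := z) ⟨hwz, hz⟩ (Set.toFinite _)
  rw [h1, ← h2] at h3
  obtain ⟨w, hw⟩ := Set.nonempty_of_ncard_ne_zero h3
  exact ⟨w, hw⟩

theorem IsDistanceRegular.exists_dist_eq [Finite V] (hX : IsDistanceRegular X) (u : V) {n : ℕ}
    (h : n ≤ X.diam) : ∃ w, X.dist u w = n := by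
  induction n with
  | zero => exact ⟨u, by simp⟩
  | succ n ih =>
    obtain ⟨w, hw⟩ := ih (by omega)
    obtain ⟨z, -, hz⟩ := hX.exists_adj_farther (u := u) (v := w) (by omega)
    exact ⟨z, by omega⟩

theorem dist_le_dist_add_one (hX : X.Connected) {u v w : V} (h : X.Adj v w) :
    X.dist u w ≤ X.dist u v + 1 := by
  have h2 : X.dist u w ≤ X.dist u v + X.dist v w := hX.dist_triangle
  rwa [SimpleGraph.dist_eq_one_iff_adj.2 h] at h2

/-- If every vertex has exactly one vertex at distance `k > 0` from it, then `k` is the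
diameter. -/
theorem IsDistanceRegular.diam_le_of_unique_dist [Finite V] (hX : IsDistanceRegular X) {k : ℕ}
    (hk : 0 < k) (huniq : ∀ u v w, X.dist u v = k → X.dist u w = k → v = w) : X.diam ≤ k := by
  obtain ⟨hc, b, c, hbc⟩ := id hX
  -- Descent: uniqueness at distance `k + 1` below the diameter gives uniqueness at distance `k`. At
  -- distance 1 each vertex has a single neighbour, contradicting a geodesic of length 2.
  induction k with
  | zero => omega
  | succ k ih =>
    by_contra! hlt
    rcases Nat.eq_zero_or_pos k with rfl | hk0
    · obtain ⟨u⟩ := hc.nonempty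
      obtain ⟨w, hw⟩ := hX.exists_dist_eq u (n := 2) (by omega)
      obtain ⟨v, hvw, hv⟩ := exists_adj_dist_eq hc hw
      have h1 : X.dist v u = 1 := by rw [X.dist_comm]; exact hv
      have h2 : X.dist v w = 1 := SimpleGraph.dist_eq_one_iff_adj.2 hvw
      have := huniq v u w h1 h2
      subst this
      simp at hw
    · refine absurd (ih hk0 ?_) (by omega)
      -- Extend `v` to `w` at distance `k + 2` from `u`. Both `x` and `y` are then at distance `k +
      -- 1` from `w`, where uniqueness applies.
      have key : ∀ u v x y, X.dist u v = k + 1 → X.Adj u x → X.dist x v = k → X.Adj u y →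
          X.dist y v = k → x = y := by
        intro u v x y huv hux hx huy hy
        obtain ⟨w, hvw, hw⟩ := hX.exists_adj_farther (u := u) (v := v) (by omega)
        have aux : ∀ x, X.Adj u x → X.dist x v = k → X.dist w x = k + 1 := by
          intro x hux hx
          have h1 := dist_le_dist_add_one hc (u := x) hvw
          have h2 := dist_le_dist_add_one hc (u := w) hux.symm
          rw [SimpleGraph.dist_comm (u := w) (v := u)] at h2
          rw [SimpleGraph.dist_comm (u := w) (v := x)] at h2 ⊢
          omega
        exact huniq w x y (aux x hux hx) (aux y huy hy)
      intro u x y hx hy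
      obtain ⟨v, hxv, hv⟩ := hX.exists_adj_farther (u := u) (v := x) (by omega)
      obtain ⟨v', hyv', hv'⟩ := hX.exists_adj_farther (u := u) (v := y) (by omega)
      obtain rfl : v = v' := huniq u v v' (by omega) (by omega)
      exact key v u x y (by rw [X.dist_comm]; omega) hxv.symm (by rw [X.dist_comm]; omega)
        hyv'.symm (by rw [X.dist_comm]; omega)

end Distance

/-! ### The algebra of polynomials in the adjacency matrix -/

section Entries

variable {V : Type*} [Fintype V] {X : SimpleGraph V} [DecidableRel X.Adj]

theorem IsDistanceRegular.exists_degree_eq (hX : IsDistanceRegular X) :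
    ∃ k, ∀ v, X.degree v = k := by
  obtain ⟨hc, b, c, hbc⟩ := hX
  refine ⟨b 0, fun v => ?_⟩
  have h := (hbc v v).2
  rw [SimpleGraph.dist_self] at h
  rw [← h, ← SimpleGraph.card_neighborFinset_eq_degree, ← Set.ncard_coe_finset]
  congr 1
  ext w
  simp [SimpleGraph.dist_eq_one_iff_adj]

theorem IsDistanceRegular.exists_sum_neighborFinset {R : Type*} [CommRing R]
    (hX : IsDistanceRegular X) (f : ℕ → R) :
    ∃ g : ℕ → R, ∀ u v, ∑ w ∈ X.neighborFinset v, f (X.dist u w) = g (X.dist u v) := by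
  obtain ⟨k, hk⟩ := hX.exists_degree_eq
  obtain ⟨hc, b, c, hbc⟩ := hX
  -- Start from all `k` neighbours at distance `i` and correct for those nearer and farther. At `i =
  -- 0` truncation makes the first correction vanish.
  refine ⟨fun i => c i * (f (i - 1) - f i) + b i * (f (i + 1) - f i) + k * f i, fun u v => ?_⟩
  beta_reduce
  obtain ⟨h1, h2⟩ := hbc u v
  have hcard : ∀ (P : V → Prop) [DecidablePred P],
      ({w | X.Adj v w ∧ P w}.ncard : R) = ∑ w ∈ X.neighborFinset v, if P w then 1 else 0 := by
    intro P _
    rw [Finset.sum_boole, ← Set.ncard_coe_finset]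
    congr 2
    ext w
    simp
  rw [← h1, ← h2, hcard, hcard, Finset.sum_mul, Finset.sum_mul, ← hk v,
    ← SimpleGraph.card_neighborFinset_eq_degree, ← nsmul_eq_mul, ← Finset.sum_const,
    ← Finset.sum_add_distrib, ← Finset.sum_add_distrib]
  refine Finset.sum_congr rfl fun w hw => ?_
  rw [SimpleGraph.mem_neighborFinset] at hw
  have h3 := dist_le_dist_add_one hc (u := u) hw
  have h4 := dist_le_dist_add_one hc (u := u) hw.symm
  rcases (by omega : X.dist u w + 1 = X.dist u v ∨ X.dist u w = X.dist u v ∨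
    X.dist u w = X.dist u v + 1) with h | h | h
  · rw [if_pos h, if_neg (by omega), ← h]; simp
  · rw [if_neg (by omega), if_neg (by omega), h]; simp
  · rw [if_neg (by omega), if_pos h, h]; simp

variable [DecidableEq V]

/-- The entries of a polynomial in the adjacency matrix of a distance-regular graph depend only
on the distance. -/
theorem IsDistanceRegular.exists_aeval_apply {R : Type*} [CommRing R]
    (hX : IsDistanceRegular X) (f : R[X]) :
    ∃ c : ℕ → R, ∀ u v, aeval (X.adjMatrix R) f u v = c (X.dist u v) := by
  induction f using Polynomial.induction_on with
  | C a =>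
    refine ⟨fun n => if n = 0 then a else 0, fun u v => ?_⟩
    simp [hX.1.dist_eq_zero_iff, Matrix.algebraMap_matrix_apply]
  | add p q hp hq =>
    obtain ⟨c, hc⟩ := hp
    obtain ⟨c', hc'⟩ := hq
    exact ⟨c + c', fun u v => by simp [hc, hc']⟩
  | monomial n a h =>
    obtain ⟨c, hc⟩ := h
    obtain ⟨g, hg⟩ := hX.exists_sum_neighborFinset c
    refine ⟨g, fun u v => ?_⟩
    rw [pow_succ, ← mul_assoc, map_mul, aeval_X, SimpleGraph.mul_adjMatrix_apply, ← hg]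
    exact Finset.sum_congr rfl fun w _ => hc u w

theorem adjMatrix_pow_apply_eq_zero {R : Type*} [CommRing R] {n : ℕ} {u v : V}
    (h : n < X.dist u v) : (X.adjMatrix R ^ n) u v = 0 := by
  rw [SimpleGraph.adjMatrix_pow_apply_eq_card_walk]
  have : IsEmpty {p : X.Walk u v | p.length = n} :=
    ⟨fun p => absurd (X.dist_le p.1) (by have := p.2; simp only [Set.mem_ofPred_eq] at this; omega)⟩
  rw [Fintype.card_eq_zero, Nat.cast_zero]

theorem adjMatrix_pow_dist_apply_ne_zero (hX : X.Connected) (u v : V) :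
    (X.adjMatrix ℝ ^ X.dist u v) u v ≠ 0 := by
  rw [SimpleGraph.adjMatrix_pow_apply_eq_card_walk]
  obtain ⟨p, hp⟩ := hX.exists_walk_length_eq_dist u v
  have : Nonempty {p : X.Walk u v | p.length = X.dist u v} := ⟨⟨p, hp⟩⟩
  exact_mod_cast Fintype.card_ne_zero

theorem aeval_adjMatrix_apply_of_natDegree_le {R : Type*} [CommRing R] {f : R[X]} {u v : V}
    (h : f.natDegree ≤ X.dist u v) : aeval (X.adjMatrix R) f u v =
      f.coeff (X.dist u v) * (X.adjMatrix R ^ X.dist u v) u v := by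
  rw [aeval_eq_sum_range' (Nat.lt_succ_of_le h), Matrix.sum_apply, Finset.sum_range_succ,
    Finset.sum_eq_zero]
  · simp
  · intro i hi
    rw [Matrix.smul_apply, adjMatrix_pow_apply_eq_zero (Finset.mem_range.1 hi), smul_zero]

/-- The matrix whose entries indicate the pairs of vertices at distance `k`. -/
noncomputable def distMatrix (X : SimpleGraph V) (R : Type*) [Zero R] [One R] (k : ℕ) : Matrix V V R :=
  Matrix.of fun u v => if X.dist u v = k then 1 else 0

/-- Coefficients in terms of the distance matrices, read off from a row. -/
noncomputable def rowMap (X : SimpleGraph V) [DecidableRel X.Adj] (u : V) {m : ℕ} (w : Fin m → V)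
    (n : ℕ) : degreeLT ℝ n →ₗ[ℝ] (Fin m → ℝ) where
  toFun f := fun i => aeval (X.adjMatrix ℝ) f.1 u (w i)
  map_add' f g := by ext i; simp
  map_smul' r f := by ext i; simp

/-- The entry of `f(A)` at distance `deg f` is the leading coefficient times a positive number of
walks. Reading one row at one vertex per distance is thus injective on degree at most `diam`, hence
surjective by dimension, and such a row determines the matrix. -/
theorem IsDistanceRegular.exists_aeval_eq_distMatrix (hX : IsDistanceRegular X) {k : ℕ} :
    ∃ p : ℝ[X], aeval (X.adjMatrix ℝ) p = distMatrix X ℝ k := by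
  rcases Nat.lt_or_ge X.diam k with hk | hk
  · refine ⟨0, ?_⟩
    ext u v
    have := dist_le_diam_of_connected hX.1 u v
    simp [distMatrix, show X.dist u v ≠ k by omega]
  obtain ⟨u⟩ := hX.1.nonempty
  choose w hw using fun i : Fin (X.diam + 1) => hX.exists_dist_eq u (n := i) (by omega)
  have hinj : Function.Injective (rowMap X u w (X.diam + 1)) := by
    rw [injective_iff_map_eq_zero]
    rintro ⟨f, hf⟩ h0
    by_contra hne
    have hne' : f ≠ 0 := fun h => hne (by simp [h])
    have hlt : f.natDegree < X.diam + 1 := (natDegree_lt_iff_degree_lt hne').2 (mem_degreeLT.1 hf)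
    have h1 := congrFun h0 ⟨f.natDegree, hlt⟩
    have h2 := hw ⟨f.natDegree, hlt⟩
    simp only at h2
    have h3 := aeval_adjMatrix_apply_of_natDegree_le (R := ℝ) h2.ge
    change aeval (X.adjMatrix ℝ) f u (w ⟨f.natDegree, hlt⟩) = 0 at h1
    rw [h1] at h3
    refine mul_ne_zero ?_ (adjMatrix_pow_dist_apply_ne_zero hX.1 u (w ⟨f.natDegree, hlt⟩)) h3.symm
    rw [h2]
    exact leadingCoeff_ne_zero.2 hne'
  have hfin : Module.finrank ℝ (degreeLT ℝ (X.diam + 1)) =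
      Module.finrank ℝ (Fin (X.diam + 1) → ℝ) := (degreeLTEquiv ℝ (X.diam + 1)).finrank_eq
  have : FiniteDimensional ℝ (degreeLT ℝ (X.diam + 1)) :=
    (degreeLTEquiv ℝ (X.diam + 1)).symm.finiteDimensional
  obtain ⟨f, hf⟩ := (LinearMap.injective_iff_surjective_of_finrank_eq_finrank hfin).1 hinj
    (fun i => if (i : ℕ) = k then 1 else 0)
  refine ⟨f.1, ?_⟩
  obtain ⟨c, hc⟩ := hX.exists_aeval_apply f.1
  ext x y
  have hlt : X.dist x y < X.diam + 1 := Nat.lt_succ_of_le (dist_le_diam_of_connected hX.1 x y)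
  have h1 := congrFun hf ⟨X.dist x y, hlt⟩
  change aeval (X.adjMatrix ℝ) f.1 u (w ⟨_, hlt⟩) = _ at h1
  rw [hc, hw] at h1
  rw [hc, distMatrix, Matrix.of_apply]
  exact h1

/-- A polynomial of degree at most `diam + 1` annihilates the adjacency matrix of a
distance-regular graph. -/
theorem IsDistanceRegular.exists_aeval_eq_zero (hX : IsDistanceRegular X) :
    ∃ p : ℝ[X], p ≠ 0 ∧ p.natDegree ≤ X.diam + 1 ∧ aeval (X.adjMatrix ℝ) p = 0 := by
  obtain ⟨u⟩ := hX.1.nonempty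
  choose w hw using fun i : Fin (X.diam + 1) => hX.exists_dist_eq u (n := i) (by omega)
  have hfin : Module.finrank ℝ (degreeLT ℝ (X.diam + 2)) = X.diam + 2 :=
    (degreeLTEquiv ℝ (X.diam + 2)).finrank_eq.trans (by simp)
  have : FiniteDimensional ℝ (degreeLT ℝ (X.diam + 2)) :=
    (degreeLTEquiv ℝ (X.diam + 2)).symm.finiteDimensional
  -- One dimension more than there are distances: some nonzero polynomial has a zero row, hence a
  -- zero matrix.
  have hker : LinearMap.ker (rowMap X u w (X.diam + 2)) ≠ ⊥ :=
    LinearMap.ker_ne_bot_of_finrank_lt (by rw [hfin]; simp)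
  obtain ⟨⟨f, hf⟩, hf0, hne⟩ := Submodule.exists_mem_ne_zero_of_ne_bot hker
  have hne' : f ≠ 0 := fun h => hne (by simp [h])
  have hlt : f.natDegree < X.diam + 2 := (natDegree_lt_iff_degree_lt hne').2 (mem_degreeLT.1 hf)
  refine ⟨f, hne', by omega, ?_⟩
  obtain ⟨c, hc⟩ := hX.exists_aeval_apply f
  ext x y
  have hlt : X.dist x y < X.diam + 1 := Nat.lt_succ_of_le (dist_le_diam_of_connected hX.1 x y)
  have h1 := congrFun (LinearMap.mem_ker.1 hf0) ⟨X.dist x y, hlt⟩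
  change aeval (X.adjMatrix ℝ) f u (w ⟨_, hlt⟩) = 0 at h1
  rw [hc, hw] at h1
  rw [hc]
  exact h1

/-- The number of vertices at a given distance does not depend on the vertex. -/
theorem IsDistanceRegular.card_dist_eq (hX : IsDistanceRegular X) (k : ℕ) (u v : V) :
    (Finset.univ.filter fun w => X.dist u w = k).card =
      (Finset.univ.filter fun w => X.dist v w = k).card := by
  obtain ⟨p, hp⟩ := hX.exists_aeval_eq_distMatrix (k := k)
  -- The diagonal of `A_k ^ 2` counts the vertices at distance `k`, and it is constant.
  obtain ⟨c, hc⟩ := hX.exists_aeval_apply (p * p)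
  have h : ∀ u, ((Finset.univ.filter fun w => X.dist u w = k).card : ℝ) = c 0 := by
    intro u
    have h := hc u u
    rw [map_mul, hp, Matrix.mul_apply, SimpleGraph.dist_self] at h
    rw [← h, Finset.card_filter]
    push_cast
    refine Finset.sum_congr rfl fun w _ => ?_
    simp [distMatrix, SimpleGraph.dist_comm (u := w) (v := u)]
  exact_mod_cast (h u).trans (h v).symm

end Entries

end

section

open Polynomial

/-! ### Spectral decomposition and the largest eigenvalue -/

section Diagonalization

variable {V : Type*} [Fintype V] [DecidableEq V]

theorem aeval_conj_diagonal {K : Type*} [Field K] {S T : Matrix V V K} (hST : S * T = 1)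
    (hTS : T * S = 1) (D : V → K) (f : K[X]) :
    aeval (S * Matrix.diagonal D * T) f = S * Matrix.diagonal (fun v => f.eval (D v)) * T := by
  induction f using Polynomial.induction_on with
  | C a =>
    simp only [aeval_C, eval_C]
    rw [← Matrix.scalar_apply, Matrix.scalar_apply, ← Matrix.smul_one_eq_diagonal,
      mul_smul_comm, mul_one, smul_mul_assoc, hST, Algebra.algebraMap_eq_smul_one]
  | add p q hp hq =>
    rw [map_add, hp, hq, ← add_mul, ← mul_add, Matrix.diagonal_add]
    simp
  | monomial n a h =>
    have : S * Matrix.diagonal (fun v => eval (D v) (C a * X ^ n)) * T * (S * Matrix.diagonal D * T)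
        = S * (Matrix.diagonal (fun v => eval (D v) (C a * X ^ n)) * (T * S) *
          Matrix.diagonal D) * T := by
      simp only [mul_assoc]
    rw [pow_succ, ← mul_assoc, map_mul, h, aeval_X, this, hTS, mul_one, Matrix.diagonal_mul_diagonal]
    simp [mul_assoc]

theorem exp_conj_diagonal {S T : Matrix V V ℂ} (hST : S * T = 1) (hTS : T * S = 1) (D : V → ℂ) :
    NormedSpace.exp (S * Matrix.diagonal D * T) =
      S * Matrix.diagonal (fun v => Complex.exp (D v)) * T := by
  have h := Matrix.exp_units_conj ⟨S, T, hST, hTS⟩ (Matrix.diagonal D)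
  simp only [Units.inv_mk] at h
  rw [h, Matrix.exp_diagonal]
  congr 3
  ext v
  rw [Pi.coe_exp, Complex.exp_eq_exp_ℂ]

theorem conj_diagonal_injective {K : Type*} [Field K] {S T : Matrix V V K}
    (hTS : T * S = 1) {D D' : V → K}
    (h : S * Matrix.diagonal D * T = S * Matrix.diagonal D' * T) : D = D' := by
  have h1 : ∀ D : V → K, T * (S * Matrix.diagonal D * T) * S = Matrix.diagonal D := by
    intro D
    have : T * (S * Matrix.diagonal D * T) * S = (T * S) * Matrix.diagonal D * (T * S) := by
      simp only [mul_assoc]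
    rw [this, hTS, one_mul, mul_one]
  have h2 := h1 D
  rw [h, h1] at h2
  exact (Matrix.diagonal_injective h2).symm

theorem trace_conj_diagonal {K : Type*} [Field K] {S T : Matrix V V K}
    (hTS : T * S = 1) (D : V → K) :
    (S * Matrix.diagonal D * T).trace = ∑ v, D v := by
  rw [Matrix.trace_mul_comm, ← mul_assoc, hTS, one_mul, Matrix.trace_diagonal]

variable {X : SimpleGraph V} [DecidableRel X.Adj] {d : ℕ} {θ : Fin (d + 1) → ℝ}

theorem IsDistinctEigenvalues.exists_diagonalization (hθ : IsDistinctEigenvalues X θ) :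
    ∃ (S T : Matrix V V ℝ) (s : V → Fin (d + 1)), S * T = 1 ∧ T * S = 1 ∧ Function.Surjective s ∧
      X.adjMatrix ℝ = S * Matrix.diagonal (fun v => θ (s v)) * T := by
  have hA : (X.adjMatrix ℝ).IsHermitian := by
    rw [Matrix.IsHermitian, Matrix.conjTranspose_eq_transpose_of_trivial,
      SimpleGraph.transpose_adjMatrix]
  have hmem : ∀ x, x ∈ spectrum ℝ (X.adjMatrix ℝ) ↔ ∃ j, θ j = x := by
    intro x
    rw [← hθ.2, Module.End.hasEigenvalue_iff_mem_spectrum, Matrix.spectrum_toLin']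
  choose s hs using fun v => (hmem _).1 (hA.eigenvalues_mem_spectrum_real v)
  refine ⟨hA.eigenvectorUnitary, star hA.eigenvectorUnitary, s, ?_, ?_, fun j => ?_, ?_⟩
  · simp
  · simp
  · have h := (hmem (θ j)).2 ⟨j, rfl⟩
    rw [hA.spectrum_real_eq_range_eigenvalues] at h
    obtain ⟨v, hv⟩ := h
    exact ⟨v, hθ.1.injective ((hs v).trans hv)⟩
  · conv_lhs => rw [hA.spectral_theorem]
    rw [Unitary.conjStarAlgAut_apply]
    simp [hs]

theorem IsDistinctEigenvalues.eval_eq_of_aeval_eq (hθ : IsDistinctEigenvalues X θ) {p q : ℝ[X]}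
    (h : aeval (X.adjMatrix ℝ) p = aeval (X.adjMatrix ℝ) q) (j : Fin (d + 1)) :
    p.eval (θ j) = q.eval (θ j) := by
  obtain ⟨S, T, s, hST, hTS, hs, hA⟩ := hθ.exists_diagonalization
  obtain ⟨v, rfl⟩ := hs j
  rw [hA, aeval_conj_diagonal hST hTS, aeval_conj_diagonal hST hTS] at h
  exact congrFun (conj_diagonal_injective hTS h) v

/-- A distance-regular graph has at most `diam + 1` distinct eigenvalues. -/
theorem IsDistinctEigenvalues.le_diam (hθ : IsDistinctEigenvalues X θ)
    (hX : IsDistanceRegular X) : d ≤ X.diam := by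
  obtain ⟨p, hp, hdeg, h0⟩ := hX.exists_aeval_eq_zero
  have hroot : ∀ j, p.eval (θ j) = 0 := fun j => by
    simpa using hθ.eval_eq_of_aeval_eq (q := 0) (by simpa using h0) j
  have h := card_le_degree_of_subset_roots (p := p)
    (Z := Finset.univ.map ⟨θ, hθ.1.injective⟩) (by
      intro x hx
      simp only [Finset.map_val, Finset.mem_val, Multiset.mem_map] at hx
      obtain ⟨j, -, rfl⟩ := hx
      exact (mem_roots hp).2 (hroot j))
  simp at h
  omega

/-- Gershgorin discs bound every eigenvalue by the row sum `k`, which the all-ones vector attains.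
-/
theorem IsDistinctEigenvalues.zero_eq_degree (hθ : IsDistinctEigenvalues X θ) [Nonempty V] {k : ℕ}
    (hk : ∀ v, X.degree v = k) : θ 0 = k := by
  apply le_antisymm
  · obtain ⟨v, hv⟩ := eigenvalue_mem_ball ((hθ.2 _).2 ⟨0, rfl⟩)
    have h1 : ∑ j ∈ Finset.univ.erase v, ‖X.adjMatrix ℝ v j‖ ≤ k := by
      calc _ ≤ ∑ j, ‖X.adjMatrix ℝ v j‖ :=
            Finset.sum_le_sum_of_subset_of_nonneg (Finset.erase_subset _ _)
              fun _ _ _ => norm_nonneg _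
        _ = ∑ j, X.adjMatrix ℝ v j := by
            refine Finset.sum_congr rfl fun j _ => ?_
            rw [SimpleGraph.adjMatrix_apply]; split_ifs <;> simp
        _ = k := by
            rw [← hk v, ← SimpleGraph.card_neighborFinset_eq_degree]
            simp [SimpleGraph.adjMatrix_apply, SimpleGraph.neighborFinset_eq_filter]
    rw [Metric.mem_closedBall, Real.dist_eq] at hv
    simp only [SimpleGraph.adjMatrix_apply, SimpleGraph.irrefl, if_false, sub_zero] at hv h1
    exact (le_abs_self _).trans (hv.trans h1)
  · have h : Module.End.HasEigenvalue (Matrix.toLin' (X.adjMatrix ℝ)) k := by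
      refine Module.End.hasEigenvalue_of_hasEigenvector (x := fun _ => 1) ⟨?_, ?_⟩
      · rw [Module.End.mem_eigenspace_iff]
        ext v
        simp [hk]
      · exact fun h => one_ne_zero (congrFun h (Classical.arbitrary V))
    obtain ⟨j, hj⟩ := (hθ.2 _).1 h
    rw [← hj]
    exact hθ.1.antitone (Fin.zero_le j)

end Diagonalization

end

/-! ### Antipodal classes of size two and the alternating spectrum of `A_diam` -/

section

open Polynomial

theorem isAntipodalWithClassSize_two_iff {V : Type*} [Finite V] {X : SimpleGraph V}
    (hX : X.Connected) : IsAntipodalWithClassSize X 2 ↔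
      0 < X.diam ∧ ∀ u, ∃ v, X.dist u v = X.diam ∧ ∀ w, X.dist u w = X.diam → w = v := by
  have hclass : 0 < X.diam → ∀ u, {v | AntipodalRel X u v}.ncard =
      {v | X.dist u v = X.diam}.ncard + 1 := by
    intro h0 u
    rw [← Set.ncard_insert_of_notMem (a := u) _ (Set.toFinite _)]
    · congr 1
      ext v
      simp [AntipodalRel, eq_comm]
    · simp; omega
  constructor
  · rintro ⟨-, h⟩
    have h0 : 0 < X.diam := by
      by_contra h0
      obtain ⟨u⟩ := hX.nonempty
      have h2 := h u
      have : {v | AntipodalRel X u v} = {u} := by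
        ext v
        simp [AntipodalRel, Nat.eq_zero_of_not_pos h0, hX.dist_eq_zero_iff, eq_comm]
      rw [this, Set.ncard_singleton] at h2
      omega
    refine ⟨h0, fun u => ?_⟩
    have h1 := hclass h0 u
    rw [h u] at h1
    obtain ⟨v, hv⟩ := Set.ncard_eq_one.1 (show {v | X.dist u v = X.diam}.ncard = 1 by omega)
    have hv' : ∀ w, X.dist u w = X.diam ↔ w = v := fun w => Set.ext_iff.1 hv w
    exact ⟨v, (hv' v).2 rfl, fun w => (hv' w).1⟩
  · rintro ⟨h0, h⟩
    refine ⟨⟨fun u => Or.inl rfl, ?_, ?_⟩, fun u => ?_⟩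
    · rintro u v (rfl | huv)
      · exact Or.inl rfl
      · exact Or.inr (by rw [X.dist_comm, huv])
    · rintro u v w (rfl | huv) (rfl | hvw)
      · exact Or.inl rfl
      · exact Or.inr hvw
      · exact Or.inr huv
      · obtain ⟨z, -, hz⟩ := h v
        exact Or.inl ((hz u (by rw [X.dist_comm, huv])).trans (hz w hvw).symm)
    · obtain ⟨v, hv, hv'⟩ := h u
      rw [hclass h0, Set.ncard_eq_one.2 ⟨v, _⟩]
      ext w
      exact ⟨hv' w, fun hw => by rw [Set.mem_singleton_iff.1 hw]; exact hv⟩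

variable {V : Type*} [Fintype V] {X : SimpleGraph V}

section AntipodalMatrix

variable {R : Type*} [CommRing R]

theorem distMatrix_diam_mul_self [DecidableEq V] (hX : X.Connected) (h : IsAntipodalWithClassSize X 2) :
    distMatrix X R X.diam * distMatrix X R X.diam = 1 := by
  obtain ⟨-, h⟩ := (isAntipodalWithClassSize_two_iff hX).1 h
  ext u w
  obtain ⟨v, hv, hv'⟩ := h u
  rw [Matrix.mul_apply, Finset.sum_eq_single v]
  · obtain ⟨z, hz, hz'⟩ := h v
    have hzu : u = z := hz' u (by rw [X.dist_comm, hv])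
    subst hzu
    by_cases huw : u = w
    · subst huw; simp [distMatrix, hv, hz]
    · have : X.dist v w ≠ X.diam := fun h => huw (hz' w h).symm
      simp [distMatrix, this, huw]
  · intro x _ hx
    have : X.dist u x ≠ X.diam := fun h => hx (hv' x h)
    simp [distMatrix, this]
  · simp

theorem distMatrix_diam_mulVec_one (hX : X.Connected) (h : IsAntipodalWithClassSize X 2) :
    distMatrix X R X.diam *ᵥ (fun _ => 1) = fun _ => 1 := by
  obtain ⟨-, h⟩ := (isAntipodalWithClassSize_two_iff hX).1 h
  ext u
  obtain ⟨v, hv, hv'⟩ := h u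
  rw [Matrix.mulVec, dotProduct, Finset.sum_eq_single v]
  · simp [distMatrix, hv]
  · intro x _ hx
    have : X.dist u x ≠ X.diam := fun h => hx (hv' x h)
    simp [distMatrix, this]
  · simp

end AntipodalMatrix

variable [DecidableEq V] [DecidableRel X.Adj] {d : ℕ} {θ : Fin (d + 1) → ℝ}

theorem aeval_adjMatrix_mulVec_one {k : ℕ} (hk : ∀ v, X.degree v = k) (f : ℝ[X]) :
    aeval (X.adjMatrix ℝ) f *ᵥ (fun _ => 1) = fun _ => f.eval (k : ℝ) := by
  have hA : X.adjMatrix ℝ *ᵥ (fun _ => 1) = (k : ℝ) • fun _ => (1 : ℝ) := by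
    ext v
    simp [hk]
  induction f using Polynomial.induction_on with
  | C a =>
    rw [aeval_C, Algebra.algebraMap_eq_smul_one, Matrix.smul_mulVec, Matrix.one_mulVec]
    ext v
    simp
  | add p q hp hq =>
    rw [map_add, Matrix.add_mulVec, hp, hq]
    ext v
    simp
  | monomial n a h =>
    rw [pow_succ, ← mul_assoc, map_mul, aeval_X, ← Matrix.mulVec_mulVec, hA, Matrix.mulVec_smul, h]
    ext v
    simp
    ring

/-- The eigenvalues of a distance matrix of maximal distance that is an involution change sign
between consecutive eigenvalues of the adjacency matrix. -/
theorem IsDistinctEigenvalues.eval_castSucc_ne_eval_succ (hθ : IsDistinctEigenvalues X θ)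
    (hX : IsDistanceRegular X) {p : ℝ[X]}
    (hp : aeval (X.adjMatrix ℝ) p = distMatrix X ℝ X.diam) (hne : ∀ j, p.eval (θ j) ≠ 0)
    (i : Fin d) :
    p.eval (θ i.castSucc) ≠ p.eval (θ i.succ) := by
  intro heq
  -- `q` kills every eigenvalue but the two in question; its degree `d - 1` is below `diam` because
  -- `d ≤ diam`.
  set J : Finset (Fin (d + 1)) := Finset.univ \ {i.castSucc, i.succ} with hJ
  set q : ℝ[X] := ∏ j ∈ J, (Polynomial.X - C (θ j)) with hq
  have hd := hθ.le_diam hX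
  have hcard : J.card + 2 = d + 1 := by
    rw [hJ, Finset.card_univ_sdiff, Fintype.card_fin,
      Finset.card_pair (by exact (Fin.castSucc_lt_succ (i := i)).ne)]
    have := i.pos
    omega
  have hdeg : q.natDegree < X.diam := by
    rw [hq, natDegree_finsetProd_X_sub_C_eq_card]
    omega
  have heval : ∀ x, q.eval x = ∏ j ∈ J, (x - θ j) := by
    intro x
    rw [hq, eval_prod]
    simp
  have hzero : ∀ j ∈ J, q.eval (θ j) = 0 := by
    intro j hj
    rw [heval]
    exact Finset.prod_eq_zero hj (sub_self _)
  -- No root of `q` lies between two consecutive eigenvalues.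
  have hpos : 0 < q.eval (θ i.castSucc) * q.eval (θ i.succ) := by
    rw [heval, heval, ← Finset.prod_mul_distrib]
    refine Finset.prod_pos fun j hj => ?_
    simp only [hJ, Finset.mem_sdiff, Finset.mem_univ, Finset.mem_insert, Finset.mem_singleton,
      not_or, true_and] at hj
    rcases lt_or_gt_of_ne hj.1 with h | h
    · have h1 := hθ.1 h
      have h2 := hθ.1 (h.trans (Fin.castSucc_lt_succ (i := i)))
      exact mul_pos_of_neg_of_neg (by linarith) (by linarith)
    · have h' : i.succ < j := lt_of_le_of_ne (Fin.castSucc_lt_iff_succ_le.1 h) (Ne.symm hj.2)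
      have h1 := hθ.1 h
      have h2 := hθ.1 h'
      exact mul_pos (by linarith) (by linarith)
  obtain ⟨S, T, s, hST, hTS, hs, hA⟩ := hθ.exists_diagonalization
  have htr : (aeval (X.adjMatrix ℝ) (p * q)).trace = 0 := by
    rw [map_mul, hp, Matrix.trace]
    refine Finset.sum_eq_zero fun x _ => ?_
    rw [Matrix.diag_apply, Matrix.mul_apply]
    refine Finset.sum_eq_zero fun y _ => ?_
    by_cases hxy : X.dist x y = X.diam
    · rw [aeval_adjMatrix_apply_of_natDegree_le (by rw [X.dist_comm]; omega),
        coeff_eq_zero_of_natDegree_lt (by rw [X.dist_comm]; omega)]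
      simp
    · simp [distMatrix, hxy]
  rw [hA, aeval_conj_diagonal hST hTS, trace_conj_diagonal hTS] at htr
  -- Multiplying by `c` makes every term of the zero trace nonnegative, and the terms at
  -- `i.castSucc` positive.
  set c := p.eval (θ i.castSucc) * q.eval (θ i.castSucc) with hc
  have hc0 : c ≠ 0 := mul_ne_zero (hne _) (left_ne_zero_of_mul hpos.ne')
  have hterm : ∀ j, 0 ≤ c * (p * q).eval (θ j) := by
    intro j
    rw [eval_mul]
    by_cases hj : j ∈ J
    · rw [hzero j hj]; simp
    · simp only [hJ, Finset.mem_sdiff, Finset.mem_univ, Finset.mem_insert, Finset.mem_singleton,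
        true_and, not_not] at hj
      rcases hj with rfl | rfl
      · exact mul_self_nonneg _
      · have : c * (p.eval (θ i.succ) * q.eval (θ i.succ)) =
            (p.eval (θ i.succ) * p.eval (θ i.succ)) *
              (q.eval (θ i.castSucc) * q.eval (θ i.succ)) := by
          rw [hc, heq]; ring
        rw [this]
        exact mul_nonneg (mul_self_nonneg _) hpos.le
  obtain ⟨v, hv⟩ := hs i.castSucc
  have hsum : 0 < ∑ v, c * (p * q).eval (θ (s v)) := by
    refine Finset.sum_pos' (fun v _ => hterm _) ⟨v, Finset.mem_univ _, ?_⟩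
    rw [hv, eval_mul]
    exact mul_self_pos.2 hc0
  rw [← Finset.mul_sum, htr, mul_zero] at hsum
  exact lt_irrefl _ hsum

/-- The values are `±1` as `A_diam` is an involution, the all-ones vector gives `1` at `θ 0`, and
consecutive values differ. -/
theorem IsDistinctEigenvalues.eval_eq_neg_one_pow (hθ : IsDistinctEigenvalues X θ)
    (hX : IsDistanceRegular X) (hanti : IsAntipodalWithClassSize X 2) {p : ℝ[X]}
    (hp : aeval (X.adjMatrix ℝ) p = distMatrix X ℝ X.diam) (j : Fin (d + 1)) :
    p.eval (θ j) = (-1) ^ (j : ℕ) := by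
  have hsq : ∀ j, p.eval (θ j) = 1 ∨ p.eval (θ j) = -1 := by
    intro j
    have h := hθ.eval_eq_of_aeval_eq (p := p * p) (q := 1)
      (by rw [map_mul, hp, distMatrix_diam_mul_self hX.1 hanti, map_one]) j
    rw [eval_mul, eval_one] at h
    exact mul_self_eq_one_iff.1 h
  have hne : ∀ j, p.eval (θ j) ≠ 0 := fun j => by
    rcases hsq j with h | h <;> rw [h] <;> norm_num
  induction j using Fin.induction with
  | zero =>
    have := hX.1.nonempty
    obtain ⟨k, hk⟩ := hX.exists_degree_eq
    have h := aeval_adjMatrix_mulVec_one hk p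
    rw [hp, distMatrix_diam_mulVec_one hX.1 hanti] at h
    rw [hθ.zero_eq_degree hk]
    simpa using (congrFun h (Classical.arbitrary V)).symm
  | succ i ih =>
    have h := hθ.eval_castSucc_ne_eval_succ hX hp hne i
    rw [ih] at h
    rw [Fin.val_castSucc] at ih h
    rw [Fin.val_succ, pow_succ]
    rcases neg_one_pow_eq_or ℝ (i : ℕ) with h1 | h1 <;> rw [h1] at h ⊢ <;>
      rcases hsq i.succ with h2 | h2 <;> rw [h2] at h ⊢ <;> simp_all

end

section

/-! ### Phases, parity and 2-adic orders -/

section Arithmetic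

theorem exp_I_mul_eq_neg_one_pow_iff (x : ℝ) (j : ℕ) :
    Complex.exp (Complex.I * x) = (-1) ^ j ↔ ∃ n : ℤ, x = Real.pi * (j + 2 * n : ℤ) := by
  have h : ((-1 : ℂ)) ^ j = Complex.exp (j * (Real.pi * Complex.I)) := by
    rw [Complex.exp_nat_mul, Complex.exp_pi_mul_I]
  rw [h, Complex.exp_eq_exp_iff_exists_int]
  refine exists_congr fun n => ?_
  have : (j : ℂ) * (Real.pi * Complex.I) + n * (2 * Real.pi * Complex.I) =
      Complex.I * ((Real.pi * (j + 2 * n : ℤ) : ℝ) : ℂ) := by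
    push_cast
    ring
  rw [this, mul_right_inj' Complex.I_ne_zero, Complex.ofReal_inj]

theorem ord₂_mul_eq_iff {a e : ℤ} (ha : a ≠ 0) : ord₂ (a * e) = ord₂ a ↔ Odd e := by
  have hfin : emultiplicity 2 a ≠ ⊤ :=
    finiteMultiplicity_iff_emultiplicity_ne_top.1
      (Int.finiteMultiplicity_iff.2 ⟨by decide, ha⟩)
  rw [ord₂, ord₂, emultiplicity_mul Int.prime_two, ← Int.not_even_iff_odd, even_iff_two_dvd,
    ← emultiplicity_eq_zero]
  constructor
  · intro h
    exact WithTop.add_left_cancel hfin (h.trans (add_zero _).symm)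
  · intro h
    rw [h, add_zero]

theorem ord₂_mul_gt_iff {a e : ℤ} (ha : a ≠ 0) : ord₂ (a * e) > ord₂ a ↔ Even e := by
  have hle : ord₂ a ≤ ord₂ (a * e) := emultiplicity_le_emultiplicity_of_dvd_right ⟨e, rfl⟩
  rw [gt_iff_lt, lt_iff_le_and_ne, ← Int.not_odd_iff_even, ← ord₂_mul_eq_iff ha]
  exact ⟨fun h h' => h.2 h'.symm, fun h => ⟨hle, fun h' => h h'.symm⟩⟩

variable {d : ℕ}

theorem eigenvalueGCD_dvd (μ : Fin (d + 1) → ℤ) (j : Fin (d + 1)) :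
    eigenvalueGCD μ ∣ μ 0 - μ j :=
  Finset.gcd_dvd (Finset.mem_univ j)

theorem parity_of_odd_multiple {μ : Fin (d + 1) → ℤ} {t : ℝ}
    (heven : ∀ j : Fin (d + 1), Even (j : ℕ) → ord₂ (μ 0 - μ j) > ord₂ (eigenvalueGCD μ))
    (hodd : ∀ j : Fin (d + 1), Odd (j : ℕ) → ord₂ (μ 0 - μ j) = ord₂ (eigenvalueGCD μ))
    {m : ℤ} (hm : Odd m) (ht : t = m * (Real.pi / (eigenvalueGCD μ : ℝ))) (j : Fin (d + 1)) :
    ∃ n : ℤ, t * ((μ 0 : ℝ) - μ j) = Real.pi * ((j : ℕ) + 2 * n : ℤ) := by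
  -- The clause `j = 0` would read `⊤ > ⊤` if the gcd were zero.
  have hα : eigenvalueGCD μ ≠ 0 := by
    intro h
    have := heven 0 (by simp)
    rw [h] at this
    simp [ord₂] at this
  obtain ⟨e, he⟩ := eigenvalueGCD_dvd μ j
  have hpar : Even (m * e - (j : ℕ)) := by
    rcases Nat.even_or_odd (j : ℕ) with hj | hj
    · have h := heven j hj
      rw [he] at h
      exact (((ord₂_mul_gt_iff hα).1 h).mul_left m).sub ((Int.even_coe_nat _).2 hj)
    · have h := hodd j hj
      rw [he] at h
      exact (hm.mul ((ord₂_mul_eq_iff hα).1 h)).sub_odd ((Int.odd_coe_nat _).2 hj)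
  obtain ⟨n, hn⟩ := hpar
  refine ⟨n, ?_⟩
  have h1 : ((j : ℕ) + 2 * n : ℤ) = m * e := by omega
  have h2 : ((μ 0 : ℝ) - μ j) = eigenvalueGCD μ * e := by exact_mod_cast he
  have h3 : (eigenvalueGCD μ : ℝ) ≠ 0 := by exact_mod_cast hα
  rw [h1, h2, ht]
  push_cast
  field_simp

/-- Here `q` stands for `t / π`. Its denominator divides every difference, hence the gcd `α`, so `m
= q α` is an integer. The phase at `j = 1` makes `m` odd, so `(μ 0 - μ j) / α` has the parity of
`j`. -/
theorem odd_multiple_of_parity {μ : Fin (d + 1) → ℤ} {q : ℚ} {n : Fin (d + 1) → ℤ}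
    (hd : 0 < d) (hn : ∀ j, q * (μ 0 - μ j : ℤ) = ((j : ℕ) + 2 * n j : ℤ)) :
    (∀ j : Fin (d + 1), Even (j : ℕ) → ord₂ (μ 0 - μ j) > ord₂ (eigenvalueGCD μ)) ∧
    (∀ j : Fin (d + 1), Odd (j : ℕ) → ord₂ (μ 0 - μ j) = ord₂ (eigenvalueGCD μ)) ∧
    ∃ m : ℤ, Odd m ∧ eigenvalueGCD μ ≠ 0 ∧ q * eigenvalueGCD μ = m := by
  have hden : (q.den : ℤ) ∣ eigenvalueGCD μ := by
    refine Finset.dvd_gcd fun j _ => ?_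
    have h : q.num * (μ 0 - μ j) = q.den * ((j : ℕ) + 2 * n j) := by
      have h1 := hn j
      have h2 := Rat.mul_den_eq_num q
      have h3 : (q.num : ℚ) * (μ 0 - μ j : ℤ) = q.den * ((j : ℕ) + 2 * n j : ℤ) := by
        rw [← h2, ← h1]; ring
      exact_mod_cast h3
    have hco : IsCoprime (q.den : ℤ) q.num := by
      rw [Int.isCoprime_iff_gcd_eq_one, Int.gcd_comm]
      exact q.reduced
    exact hco.dvd_of_dvd_mul_left ⟨_, h⟩
  obtain ⟨a, ha⟩ := hden
  have hm : q * eigenvalueGCD μ = (q.num * a : ℤ) := by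
    rw [ha]
    push_cast
    rw [← mul_assoc, Rat.mul_den_eq_num]
  choose e he using eigenvalueGCD_dvd μ
  have hme : ∀ j, (q.num * a) * e j = (j : ℕ) + 2 * n j := by
    intro j
    have h := hn j
    rw [he j, Int.cast_mul, ← mul_assoc, hm, ← Int.cast_mul] at h
    exact Int.cast_injective h
  have h1 : Odd ((q.num * a) * e ⟨1, by omega⟩) := by
    rw [hme]
    exact ⟨n ⟨1, by omega⟩, by push_cast; ring⟩
  have hmodd : Odd (q.num * a) := (Int.odd_mul.1 h1).1
  have hα : eigenvalueGCD μ ≠ 0 := by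
    intro h
    rw [h, Int.cast_zero, mul_zero] at hm
    have : q.num * a = 0 := by exact_mod_cast hm.symm
    rw [this] at hmodd
    simp at hmodd
  have hpar : ∀ j, Even (e j) ↔ Even (j : ℕ) := by
    intro j
    have h : Even ((q.num * a) * e j) ↔ Even (e j) := by
      rw [Int.even_mul]
      simp [hmodd]
    rw [← h, hme, Int.even_add]
    simp
  refine ⟨fun j hj => ?_, fun j hj => ?_, q.num * a, hmodd, hα, hm⟩
  · rw [he j, ord₂_mul_gt_iff hα]
    exact (hpar j).2 hj
  · rw [he j, ord₂_mul_eq_iff hα, ← Int.not_even_iff_odd, hpar, Nat.not_even_iff_odd]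
    exact hj

end Arithmetic

/-! ### Integrality of the eigenvalues -/

section Eigenvalues

open Polynomial

variable {V : Type*} [Fintype V] [DecidableEq V] {X : SimpleGraph V} [DecidableRel X.Adj] {d : ℕ}
  {θ : Fin (d + 1) → ℝ}

theorem IsDistinctEigenvalues.isIntegral (hθ : IsDistinctEigenvalues X θ) (j : Fin (d + 1)) :
    IsIntegral ℤ (θ j) := by
  have hmap : (X.adjMatrix ℤ).map (Int.castRingHom ℝ) = X.adjMatrix ℝ := by
    ext u v
    simp [SimpleGraph.adjMatrix_apply]
  refine ⟨(X.adjMatrix ℤ).charpoly, Matrix.charpoly_monic _, ?_⟩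
  have h := hθ.eval_eq_of_aeval_eq (p := (X.adjMatrix ℝ).charpoly) (q := 0)
    (by rw [Matrix.aeval_self_charpoly, map_zero]) j
  rw [← hmap, Matrix.charpoly_map, eval_map, eval_zero] at h
  exact h

theorem exists_int_eq_of_isIntegral {x : ℝ} (hx : IsIntegral ℤ x) {r : ℚ} (hr : (r : ℝ) = x) :
    ∃ n : ℤ, x = n := by
  have h : IsIntegral ℤ (algebraMap ℚ ℝ r) := by rw [eq_ratCast, hr]; exact hx
  rw [isIntegral_algebraMap_iff (algebraMap ℚ ℝ).injective,
    IsIntegrallyClosed.isIntegral_iff] at h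
  obtain ⟨n, hn⟩ := h
  refine ⟨n, ?_⟩
  rw [← hr, ← hn]
  simp

theorem IsDistinctEigenvalues.exists_sum_eq_zero (hθ : IsDistinctEigenvalues X θ) :
    ∃ s : V → Fin (d + 1), ∑ v, θ (s v) = 0 := by
  obtain ⟨S, T, s, hST, hTS, hs, hA⟩ := hθ.exists_diagonalization
  refine ⟨s, ?_⟩
  rw [← trace_conj_diagonal hTS, ← hA, SimpleGraph.trace_adjMatrix]

/-- If the phases at all eigenvalues alternate, then the eigenvalues are integers, with the
prescribed parities, and the time is an odd multiple of `π / gcd`. -/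
theorem IsDistinctEigenvalues.exists_int_of_phases (hθ : IsDistinctEigenvalues X θ)
    (hX : IsDistanceRegular X) (hdiam : 0 < X.diam) {t : ℝ} {n : Fin (d + 1) → ℤ}
    (hn : ∀ j, t * (θ 0 - θ j) = Real.pi * ((j : ℕ) + 2 * n j : ℤ)) :
    ∃ μ : Fin (d + 1) → ℤ, (∀ j, θ j = (μ j : ℝ)) ∧
      (∀ j : Fin (d + 1), Even (j : ℕ) → ord₂ (μ 0 - μ j) > ord₂ (eigenvalueGCD μ)) ∧
      (∀ j : Fin (d + 1), Odd (j : ℕ) → ord₂ (μ 0 - μ j) = ord₂ (eigenvalueGCD μ)) ∧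
      ∃ m : ℤ, Odd m ∧ t = (m : ℝ) * (Real.pi / (eigenvalueGCD μ : ℝ)) := by
  have := hX.1.nonempty
  obtain ⟨k, hk⟩ := hX.exists_degree_eq
  have hθ0 := hθ.zero_eq_degree hk
  have hk0 : 0 < k := by
    obtain ⟨u⟩ := hX.1.nonempty
    obtain ⟨w, hw⟩ := hX.exists_dist_eq u (n := 1) (by omega)
    rw [← hk u, SimpleGraph.degree_pos_iff_exists_adj]
    exact ⟨w, SimpleGraph.dist_eq_one_iff_adj.1 hw⟩
  have hk0' : (0 : ℝ) < k := by exact_mod_cast hk0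
  obtain ⟨s, hs⟩ := hθ.exists_sum_eq_zero
  have hN : (0 : ℝ) < Fintype.card V := by exact_mod_cast Fintype.card_pos
  have hd : 0 < d := by
    by_contra h0
    obtain rfl : d = 0 := by omega
    have h1 : ∀ v, s v = 0 := fun v => Fin.ext (by omega)
    simp only [h1, hθ0, Finset.sum_const, Finset.card_univ, nsmul_eq_mul] at hs
    exact (mul_pos hN hk0').ne' hs
  have hpi := Real.pi_pos
  -- Summed with multiplicity, the eigenvalues vanish and only the copies of `θ 0 = k` remain.
  have hsum : t * (Fintype.card V * k) = Real.pi * (∑ v, ((s v : ℕ) + 2 * n (s v) : ℤ) : ℤ) := by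
    have h1 : ∑ v, t * (θ 0 - θ (s v)) = t * (Fintype.card V * k) := by
      rw [← Finset.mul_sum, Finset.sum_sub_distrib, hs, hθ0]
      simp
    rw [← h1, Int.cast_sum, Finset.mul_sum]
    exact Finset.sum_congr rfl fun v _ => hn (s v)
  set q : ℚ := (∑ v, ((s v : ℕ) + 2 * n (s v) : ℤ) : ℤ) / (Fintype.card V * k) with hq
  have ht : t = Real.pi * q := by
    rw [hq]
    push_cast at hsum ⊢
    field_simp
    linarith
  have hq1 : ∀ j, (q : ℝ) * (θ 0 - θ j) = ((j : ℕ) + 2 * n j : ℤ) := by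
    intro j
    have h := hn j
    rw [ht, mul_assoc] at h
    exact mul_left_cancel₀ hpi.ne' h
  have hq0 : (q : ℝ) ≠ 0 := by
    intro h0
    have h := hq1 ⟨1, by omega⟩
    rw [h0, zero_mul] at h
    have h' : (((1 : ℕ) : ℤ) + 2 * n ⟨1, by omega⟩) = 0 := by exact_mod_cast h.symm
    omega
  have hint : ∀ j, ∃ m : ℤ, θ j = m := by
    intro j
    refine exists_int_eq_of_isIntegral (hθ.isIntegral j)
      -- The phase condition solved for `θ j`, with `θ 0 = k`.
      (r := k - ((j : ℕ) + 2 * n j : ℤ) / q) ?_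
    have h := hq1 j
    rw [hθ0] at h
    rw [Rat.cast_sub, Rat.cast_div, Rat.cast_intCast, ← h, Rat.cast_natCast]
    field_simp
    ring
  choose μ hμ using hint
  obtain ⟨h1, h2, m, hm, hα, hqm⟩ := odd_multiple_of_parity (μ := μ) (q := q) (n := n) hd (by
    intro j
    have h := hq1 j
    rw [hμ, hμ] at h
    exact_mod_cast h)
  refine ⟨μ, hμ, h1, h2, m, hm, ?_⟩
  have hα' : (eigenvalueGCD μ : ℝ) ≠ 0 := by exact_mod_cast hα
  have hqm' : (q : ℝ) * eigenvalueGCD μ = m := by exact_mod_cast hqm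
  rw [ht, ← hqm']
  field_simp

end Eigenvalues

end


/-! ### The transition matrix and perfect state transfer -/

open Polynomial

variable {V : Type*} [Fintype V] [DecidableEq V] {X : SimpleGraph V} [DecidableRel X.Adj] {d : ℕ}
  {θ : Fin (d + 1) → ℝ}

theorem IsDistinctEigenvalues.exists_complex_diagonalization (hθ : IsDistinctEigenvalues X θ) :
    ∃ (S T : Matrix V V ℂ) (s : V → Fin (d + 1)), S * T = 1 ∧ T * S = 1 ∧ Function.Surjective s ∧
      X.adjMatrix ℂ = S * Matrix.diagonal (fun v => (θ (s v) : ℂ)) * T ∧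
      ∀ p : ℝ[X], (aeval (X.adjMatrix ℝ) p).map Complex.ofRealHom =
        S * Matrix.diagonal (fun v => ((p.eval (θ (s v)) : ℝ) : ℂ)) * T := by
  obtain ⟨S, T, s, hST, hTS, hs, hA⟩ := hθ.exists_diagonalization
  have hconj : ∀ D : V → ℝ, (S * Matrix.diagonal D * T).map Complex.ofRealHom =
      S.map Complex.ofRealHom * Matrix.diagonal (fun v => (D v : ℂ)) *
        T.map Complex.ofRealHom := by
    intro D
    rw [Matrix.map_mul, Matrix.map_mul, Matrix.diagonal_map (map_zero _)]
    rfl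
  refine ⟨S.map Complex.ofRealHom, T.map Complex.ofRealHom, s, ?_, ?_, hs, ?_, fun p => ?_⟩
  · rw [← Matrix.map_mul, hST, Matrix.map_one _ (map_zero _) (map_one _)]
  · rw [← Matrix.map_mul, hTS, Matrix.map_one _ (map_zero _) (map_one _)]
  · rw [← hconj, ← hA]
    ext u v
    by_cases h : X.Adj u v <;> simp [SimpleGraph.adjMatrix_apply, h]
  · rw [hA, aeval_conj_diagonal hST hTS, hconj]

theorem transitionMatrix_eq_conj_diagonal {S T : Matrix V V ℂ} (hST : S * T = 1) (hTS : T * S = 1)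
    {D : V → ℂ} (hA : X.adjMatrix ℂ = S * Matrix.diagonal D * T) (t : ℝ) :
    transitionMatrix X t =
      S * Matrix.diagonal (fun v => Complex.exp (Complex.I * t * D v)) * T := by
  rw [transitionMatrix, hA, ← smul_mul_assoc, ← mul_smul_comm, ← Matrix.diagonal_smul,
    exp_conj_diagonal hST hTS]
  rfl

/-- The entries of the transition matrix of a distance-regular graph depend only on the
distance. -/
theorem IsDistinctEigenvalues.exists_transitionMatrix_apply (hθ : IsDistinctEigenvalues X θ)
    (hX : IsDistanceRegular X) (t : ℝ) :
    ∃ c : ℕ → ℂ, ∀ u v, transitionMatrix X t u v = c (X.dist u v) := by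
  obtain ⟨S, T, s, hST, hTS, hs, hA, -⟩ := hθ.exists_complex_diagonalization
  -- Interpolating the exponential at the eigenvalues exhibits `U(t)` as a polynomial in `A`.
  set L : ℂ[X] := Lagrange.interpolate Finset.univ (fun j => (θ j : ℂ))
    (fun j => Complex.exp (Complex.I * t * θ j)) with hL
  have hLj : ∀ j, L.eval (θ j : ℂ) = Complex.exp (Complex.I * t * θ j) := fun j =>
    Lagrange.eval_interpolate_at_node _
      ((Complex.ofReal_injective.comp hθ.1.injective).injOn) (Finset.mem_univ j)
  obtain ⟨c, hc⟩ := hX.exists_aeval_apply L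
  refine ⟨c, fun u v => ?_⟩
  rw [← hc, transitionMatrix_eq_conj_diagonal hST hTS hA]
  conv_rhs => rw [hA, aeval_conj_diagonal hST hTS]
  simp only [hLj]

theorem IsDistinctEigenvalues.transitionMatrix_eq_smul_distMatrix_iff
    (hθ : IsDistinctEigenvalues X θ) {k : ℕ} {p : ℝ[X]}
    (hp : aeval (X.adjMatrix ℝ) p = distMatrix X ℝ k) (t : ℝ) (γ : ℂ) :
    transitionMatrix X t = γ • distMatrix X ℂ k ↔
      ∀ j, Complex.exp (Complex.I * t * θ j) = γ * (p.eval (θ j) : ℝ) := by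
  obtain ⟨S, T, s, hST, hTS, hs, hA, hmap⟩ := hθ.exists_complex_diagonalization
  have hdist : distMatrix X ℂ k =
      S * Matrix.diagonal (fun v => ((p.eval (θ (s v)) : ℝ) : ℂ)) * T := by
    rw [← hmap, hp]
    ext u v
    by_cases h : X.dist u v = k <;> simp [distMatrix, h]
  rw [hdist, transitionMatrix_eq_conj_diagonal hST hTS hA, ← smul_mul_assoc, ← mul_smul_comm,
    ← Matrix.diagonal_smul]
  constructor
  · intro h j
    obtain ⟨v, rfl⟩ := hs j
    exact congrFun (conj_diagonal_injective hTS h) v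
  · intro h
    congr 3
    ext v
    exact h (s v)

theorem transitionMatrix_mulVec_ne_zero (t : ℝ) {x : V → ℂ} (hx : x ≠ 0) :
    transitionMatrix X t *ᵥ x ≠ 0 := by
  have h : IsUnit (transitionMatrix X t) := Matrix.isUnit_exp _
  intro h0
  exact hx (Matrix.mulVec_injective_of_isUnit h (by rw [h0, Matrix.mulVec_zero]))

theorem IsDistinctEigenvalues.hasPerfectStateTransfer_iff (hθ : IsDistinctEigenvalues X θ)
    (hX : IsDistanceRegular X) (t : ℝ) :
    HasPerfectStateTransfer X t ↔ IsAntipodalWithClassSize X 2 ∧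
      ∃ γ : ℂ, transitionMatrix X t = γ • distMatrix X ℂ X.diam := by
  rw [isAntipodalWithClassSize_two_iff hX.1]
  constructor
  · rintro ⟨u, v, huv, γ, h⟩
    have hγ : γ ≠ 0 := by
      rintro rfl
      refine transitionMatrix_mulVec_ne_zero t ?_ (h.trans (zero_smul _ _))
      simp
    obtain ⟨c, hc⟩ := hθ.exists_transitionMatrix_apply hX t
    have hentry : ∀ w, c (X.dist u w) = if w = v then γ else 0 := by
      intro w
      have h1 := congrFun h w
      rw [Matrix.mulVec_single_one, Matrix.col_apply, hc, X.dist_comm] at h1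
      rw [h1]
      simp [Pi.single_apply]
    set k := X.dist u v with hk
    have hck : c k = γ := by rw [hk, hentry, if_pos rfl]
    have hkpos : 0 < k := hX.1.pos_dist_of_ne huv
    have hc0 : ∀ i ≤ X.diam, i ≠ k → c i = 0 := by
      intro i hi hik
      obtain ⟨w, hw⟩ := hX.exists_dist_eq u hi
      rw [← hw, hentry, if_neg]
      rintro rfl
      exact hik hw.symm
    -- A second vertex at distance `k` from `u` would also carry the amplitude `γ ≠ 0`; the count is
    -- the same at every vertex.
    have hcard : ∀ x, (Finset.univ.filter fun w => X.dist x w = k).card = 1 := by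
      intro x
      rw [hX.card_dist_eq k x u, Finset.card_eq_one]
      refine ⟨v, ?_⟩
      ext w
      simp only [Finset.mem_filter, Finset.mem_univ, true_and, Finset.mem_singleton]
      refine ⟨fun hw => ?_, fun hw => by rw [hw]⟩
      by_contra hne
      have h1 := hentry w
      rw [hw, hck, if_neg hne] at h1
      exact hγ h1
    have huniq : ∀ x, ∃ y, X.dist x y = k ∧ ∀ w, X.dist x w = k → w = y := by
      intro x
      obtain ⟨y, hy⟩ := Finset.card_eq_one.1 (hcard x)
      have hy' : ∀ w, X.dist x w = k ↔ w = y := fun w => by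
        simpa using Finset.ext_iff.1 hy w
      exact ⟨y, (hy' y).2 rfl, fun w => (hy' w).1⟩
    have hdiam : X.diam = k := by
      apply le_antisymm _ (dist_le_diam_of_connected hX.1 u v)
      refine hX.diam_le_of_unique_dist hkpos fun x y z hy hz => ?_
      obtain ⟨w, -, hw⟩ := huniq x
      rw [hw y hy, hw z hz]
    refine ⟨by rw [hdiam]; exact ⟨hkpos, huniq⟩, γ, ?_⟩
    ext x y
    rw [hc, Matrix.smul_apply, distMatrix, Matrix.of_apply, hdiam]
    split_ifs with hxy
    · rw [hxy, hck]; simp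
    · rw [hc0 _ (dist_le_diam_of_connected hX.1 x y) hxy]; simp
  · rintro ⟨⟨h0, h⟩, γ, hγ⟩
    obtain ⟨u⟩ := hX.1.nonempty
    obtain ⟨v, hv, hv'⟩ := h u
    refine ⟨u, v, ?_, γ, ?_⟩
    · rintro rfl
      rw [SimpleGraph.dist_self] at hv
      omega
    · ext w
      rw [hγ, Matrix.mulVec_single_one, Matrix.col_apply, Matrix.smul_apply, Pi.smul_apply,
        distMatrix, Matrix.of_apply, X.dist_comm, Pi.single_apply]
      congr 1
      exact if_congr ⟨hv' w, fun hw => by rw [hw, hv]⟩ rfl rfl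

/-- The equation at `j = 0` forces `γ = exp (i t θ 0)`; dividing by it leaves conditions on
eigenvalue differences alone. -/
theorem IsDistinctEigenvalues.hasPerfectStateTransfer_iff_phases (hθ : IsDistinctEigenvalues X θ)
    (hX : IsDistanceRegular X) (t : ℝ) :
    HasPerfectStateTransfer X t ↔ IsAntipodalWithClassSize X 2 ∧
      ∀ j, ∃ n : ℤ, t * (θ 0 - θ j) = Real.pi * ((j : ℕ) + 2 * n : ℤ) := by
  rw [hθ.hasPerfectStateTransfer_iff hX]
  refine and_congr_right fun hanti => ?_
  obtain ⟨p, hp⟩ := hX.exists_aeval_eq_distMatrix (k := X.diam)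
  simp only [hθ.transitionMatrix_eq_smul_distMatrix_iff hp, hθ.eval_eq_neg_one_pow hX hanti hp,
    ← exp_I_mul_eq_neg_one_pow_iff]
  have hsq : ∀ j : ℕ, ((-1 : ℂ)) ^ j * (-1) ^ j = 1 := fun j => by
    rw [← mul_pow]; simp
  have hexp : ∀ j, Complex.exp (Complex.I * (t * (θ 0 - θ j) : ℝ)) *
      Complex.exp (Complex.I * t * θ j) = Complex.exp (Complex.I * t * θ 0) := by
    intro j
    rw [← Complex.exp_add]
    congr 1
    push_cast
    ring
  constructor
  · rintro ⟨γ, h⟩ j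
    have h0 := h 0
    simp only [Fin.val_zero, pow_zero, Complex.ofReal_one, mul_one] at h0
    have h1 := hexp j
    have h2 := h j
    push_cast at h2
    rw [h0] at h1
    have hγ : γ ≠ 0 := by rw [← h0]; exact Complex.exp_ne_zero _
    rw [h2] at h1
    refine mul_left_cancel₀ (mul_ne_zero hγ (pow_ne_zero (j : ℕ) (neg_ne_zero.2 one_ne_zero))) ?_
    rw [mul_comm, h1, mul_assoc, hsq, mul_one]
  · intro h
    refine ⟨Complex.exp (Complex.I * t * θ 0), fun j => ?_⟩
    rw [← hexp j, h j]
    push_cast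
    rw [mul_right_comm ((-1 : ℂ) ^ (j : ℕ)), hsq, one_mul]

end QuantumWalk

theorem mainTheorem2 {V : Type*} [Fintype V] [DecidableEq V]
    (X : SimpleGraph V) [DecidableRel X.Adj]
    (hX : QuantumWalk.IsDistanceRegular X)
    {d : ℕ} (θ : Fin (d + 1) → ℝ) (hθ : QuantumWalk.IsDistinctEigenvalues X θ) (t : ℝ) :
    QuantumWalk.HasPerfectStateTransfer X t ↔
      QuantumWalk.IsAntipodalWithClassSize X 2 ∧
      ∃ μ : Fin (d + 1) → ℤ, (∀ j, θ j = (μ j : ℝ)) ∧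
        (∀ j : Fin (d + 1), Even (j : ℕ) →
          QuantumWalk.ord₂ (μ 0 - μ j) > QuantumWalk.ord₂ (QuantumWalk.eigenvalueGCD μ)) ∧
        (∀ j : Fin (d + 1), Odd (j : ℕ) →
          QuantumWalk.ord₂ (μ 0 - μ j) = QuantumWalk.ord₂ (QuantumWalk.eigenvalueGCD μ)) ∧
        ∃ m : ℤ, Odd m ∧ t = (m : ℝ) * (Real.pi / (QuantumWalk.eigenvalueGCD μ : ℝ)) := by
  rw [hθ.hasPerfectStateTransfer_iff_phases hX]
  refine and_congr_right fun hanti => ⟨fun h => ?_, ?_⟩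
  · choose n hn using h
    exact hθ.exists_int_of_phases hX
      ((QuantumWalk.isAntipodalWithClassSize_two_iff hX.1).1 hanti).1 hn
  · rintro ⟨μ, hμ, heven, hodd, m, hm, ht⟩ j
    rw [hμ, hμ]
    exact QuantumWalk.parity_of_odd_multiple heven hodd hm ht j
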